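/- Let $G$ be a small groupoid. Write $G(x,y)$ for the set of morphisms with source $x$ and target $y$, and $gf$ for the composite "first $f$, then $g$". Let $P$ be a wide subcategory of $G$, with $P(x,y)=P\cap G(x,y)$. For morphisms $f,g$ with the same target write $f\le g$ if $f^{-1}g\in P$, and $f<g$ if $f\le g$ and $f\ne g$. Assume that $(G,P)$ is a quasi-lattice ordered groupoid: $P(x,y)\cap P(y,x)^{-1}$ is $\{1_x\}$ if $x=y$ and empty otherwise, and every finite nonempty set of morphisms of $G$ that has an upper bound in $P$ has a least upper bound in $P$. Let $X=(\{A_x\}_{x},\{X_f\}_{f\in P})$ be a product system over $(G,P)$. That is, each $A_x$ is a $C^*$-algebra; for $f\in P(x,y)$, $X_f$ is a right Hilbert $A_x$-module with a non-degenerate left action $\phi_f:A_y\to\mathcal L(X_f)$ by adjointable operators; $X_{1_x}=A_x$ with its standard structure; and there are isomorphisms of $C^*$-correspondences $X_g\otimes X_f\to X_{gf}$, $\xi\otimes\eta\mapsto\xi\eta$ (interior tensor product), which are associative and, when $g$ or $f$ is an identity, given by the left or right action. For $h\in P(x,x)$ let $$I_h=\bigcap_{1_x<f\le h}\ker\phi_f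 ,$$ an ideal of $A_x$, where $f$ runs over the morphisms of $P$ with target $x$ and arbitrary source such that $1_x<f\le h$ (so $I_{1_x}=A_x$). For $g\in P(x,y)$ let $\widetilde X_g$ be the completion of the pre-Hilbert right $A_x$-module of finitely supported families $\xi=(\xi(f))$, indexed by $f\in P(x,y)$ with $f\le g$, such that $\xi(f)\in X_f I_{f^{-1}g}$, with inner product $\langle\xi,\eta\rangle=\sum_f\langle\xi(f),\eta(f)\rangle$. Let $\widetilde\phi_g:A_y\to\mathcal L(\widetilde X_g)$ be the left action induced by $(\widetilde\phi_g(a)\xi)(f)=\phi_f(a)\xi(f)$. We say that $X$ is $\widetilde\phi$-injective if $\widetilde\phi_g$ is injective for all $x,y$ and all $g\in P(x,y)$. A set $S\subseteq P(x,y)$ is bounded if there is a morphism $g$ in $P$ with target $y$ such that $k\le g$ for all $k\in S$. An element $f\in S$ is maximal (respectively minimal) in $S$ if $f\not\le h$ (respectively $h\not\le f$) for all $h\in S\setminus\{f\}$. Then: 1. If $\phi_f$ is injective for every $f\in P$, then $X$ is $\widetilde\phi$-injective. 2. Suppose that, for all objects $x,y$, every nonempty bounded subset of $P(x,y)$ has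 a maximal element, and that, for all $x,y$ and every $k\in P(x,y)$, the set $\{f\in P(x,y): f\le k\}$ has a minimal element $f'$ such that $\phi_{f'}$ is injective. Then $X$ is $\widetilde\phi$-injective. -/

import Mathlib

open CategoryTheory

universe w v u

/-! ### Pre-Hilbert and Hilbert right modules over a C⋆-algebra -/

/-- A right pre-Hilbert module `E` over a C⋆-algebra `B`. The inner product is linear in its second
variable. (Mathlib's `CStarModule` is the left-handed notion, `⟪x, a • y⟫ = a * ⟪x, y⟫`.) -/
class PreHilbertModule (B : Type*) (E : Type*) [NonUnitalCStarAlgebra B] [PartialOrder B]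
    [AddCommGroup E] [Module ℂ E] where
  /-- the right action `ξ · b` -/
  rsmul : E →ₗ[ℂ] B →ₗ[ℂ] E
  /-- the `B`-valued inner product -/
  ip : E → E → B
  rsmul_rsmul : ∀ (ξ : E) (b c : B), rsmul (rsmul ξ b) c = rsmul ξ (b * c)
  ip_add_right : ∀ ξ η ζ : E, ip ξ (η + ζ) = ip ξ η + ip ξ ζ
  ip_smul_right : ∀ (z : ℂ) (ξ η : E), ip ξ (z • η) = z • ip ξ η
  ip_rsmul_right : ∀ (ξ η : E) (b : B), ip ξ (rsmul η b) = ip ξ η * b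
  star_ip : ∀ ξ η : E, star (ip ξ η) = ip η ξ
  ip_self_nonneg : ∀ ξ : E, 0 ≤ ip ξ ξ
  eq_zero_of_ip_self : ∀ ξ : E, ip ξ ξ = 0 → ξ = 0

namespace PreHilbertModule

variable {B E : Type*} [NonUnitalCStarAlgebra B] [PartialOrder B]
  [AddCommGroup E] [Module ℂ E] [PreHilbertModule B E]

theorem ip_add_left (ξ η ζ : E) : ip (B := B) (ξ + η) ζ = ip ξ ζ + ip η ζ := by
  rw [← star_ip, ip_add_right, star_add, star_ip, star_ip]

theorem ip_smul_left (z : ℂ) (ξ η : E) : ip (B := B) (z • ξ) η = star z • ip ξ η := by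
  rw [← star_ip, ip_smul_right, star_smul, star_ip]

theorem ip_rsmul_left (ξ η : E) (b : B) : ip (rsmul ξ b) η = star b * ip ξ η := by
  rw [← star_ip, ip_rsmul_right, star_mul, star_ip]

theorem ip_sub_right (ξ η ζ : E) : ip (B := B) ξ (η - ζ) = ip ξ η - ip ξ ζ := by
  have h : η - ζ = η + (-1 : ℂ) • ζ := by simp [sub_eq_add_neg]
  rw [h, ip_add_right, ip_smul_right]
  simp [sub_eq_add_neg]

theorem ip_sub_left (ξ η ζ : E) : ip (B := B) (ξ - η) ζ = ip ξ ζ - ip η ζ := by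
  rw [← star_ip, ip_sub_right, star_sub, star_ip, star_ip]

theorem ip_zero_right (ξ : E) : ip (B := B) ξ 0 = 0 := by
  simpa using ip_sub_right (B := B) ξ 0 0

theorem ip_zero_left (ξ : E) : ip (B := B) 0 ξ = 0 := by
  simpa using ip_sub_left (B := B) 0 0 ξ

theorem ip_right_ext (ξ η : E) (h : ∀ ζ : E, ip (B := B) ζ ξ = ip ζ η) : ξ = η := by
  rw [← sub_eq_zero]
  exact eq_zero_of_ip_self (B := B) _ (by rw [ip_sub_right, h, sub_self])

variable [StarOrderedRing B]

theorem ip_mul_ip_le (ξ η : E) :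
    ip (B := B) η ξ * ip ξ η ≤ ‖ip (B := B) ξ ξ‖ • ip η η := by
  set r : ℝ := ‖ip (B := B) ξ ξ‖ with hr
  rcases eq_or_ne ξ 0 with h | h
  · subst h
    simp [hr, ip_zero_right, ip_zero_left]
  have hpos : 0 < r := norm_pos_iff.2 fun h0 => h (eq_zero_of_ip_self (B := B) _ h0)
  have hR : ∀ ζ ζ' : E, ip (B := B) ζ ((r : ℂ) • ζ') = r • ip ζ ζ' := fun ζ ζ' => by
    rw [ip_smul_right, Complex.coe_smul]
  have hL : ∀ ζ ζ' : E, ip (B := B) ((r : ℂ) • ζ) ζ' = r • ip ζ ζ' := fun ζ ζ' => by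
    rw [ip_smul_left, Complex.star_def, Complex.conj_ofReal, Complex.coe_smul]
  have key : ∀ b : B, 0 ≤ r • (star b * b) - r • (star b * ip ξ η)
      - r • (ip η ξ * b) + r • (r • ip η η) := fun b => by
    calc (0 : B) ≤ ip (rsmul ξ b - (r : ℂ) • η) (rsmul ξ b - (r : ℂ) • η) := ip_self_nonneg _
      _ = star b * ip ξ ξ * b - r • (star b * ip ξ η)
            - r • (ip η ξ * b) + r • (r • ip η η) := by
          simp only [ip_sub_left, ip_sub_right, ip_rsmul_left, ip_rsmul_right, hR, hL,
            mul_assoc, smul_mul_assoc, sub_mul, smul_sub]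
          abel
      _ ≤ r • (star b * b) - r • (star b * ip ξ η)
            - r • (ip η ξ * b) + r • (r • ip η η) := by
          gcongr
          exact CStarAlgebra.star_left_conjugate_le_norm_smul (hb := (star_ip ξ ξ))
  have h1 := key (ip ξ η)
  simp only [star_ip, sub_self, zero_sub, le_neg_add_iff_add_le, add_zero] at h1
  rwa [smul_le_smul_iff_of_pos_left hpos] at h1

theorem norm_ip_sq_le (ξ η : E) :
    ‖ip (B := B) ξ η‖ ^ 2 ≤ ‖ip (B := B) ξ ξ‖ * ‖ip (B := B) η η‖ := by
  calc ‖ip (B := B) ξ η‖ ^ 2 = ‖ip (B := B) η ξ * ip ξ η‖ := by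
        rw [← star_ip ξ η, CStarRing.norm_star_mul_self, pow_two]
    _ ≤ ‖‖ip (B := B) ξ ξ‖ • ip (B := B) η η‖ := by
        refine CStarAlgebra.norm_le_norm_of_nonneg_of_le ?_ (ip_mul_ip_le ξ η)
        rw [← star_ip ξ η]
        exact star_mul_self_nonneg _
    _ = _ := by rw [norm_smul, norm_norm]

/-- A `*`-homomorphism into adjointable operators is contractive, at the level of inner products:
`⟪a ξ, a ξ⟫ ≤ ‖a‖² ⟪ξ, ξ⟫`. -/
theorem ip_action_le {A : Type*} [NonUnitalCStarAlgebra A] (φ : A →ₗ[ℂ] E →ₗ[ℂ] E)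
    (hmul : ∀ (a b : A) (ξ : E), φ (a * b) ξ = φ a (φ b ξ))
    (hadj : ∀ (a : A) (ξ η : E), ip (B := B) (φ a ξ) η = ip ξ (φ (star a) η)) (a : A) (ξ : E) :
    ip (B := B) (φ a ξ) (φ a ξ) ≤ (‖a‖ ^ 2) • ip ξ ξ := by
  let _ : PartialOrder A := CStarAlgebra.spectralOrder A
  have _ : StarOrderedRing A := CStarAlgebra.spectralOrderedRing A
  set r : ℝ := ‖a‖ with hr
  have hr0 : 0 ≤ r := norm_nonneg a
  set b : A := star a * a with hb
  have hbsa : IsSelfAdjoint b := IsSelfAdjoint.star_mul_self a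
  set s : ℝ → ℝ := fun t => r - √(r ^ 2 - t) with hs
  have hs0 : s 0 = 0 := by simp [hs, Real.sqrt_sq hr0]
  have hsc : Continuous s := by fun_prop
  set e : A := cfcₙ s b with he
  have hesa : star e = e := (cfcₙ_predicate s b : IsSelfAdjoint e)
  have hid : (2 * r) • e - e * e = b := by
    have h1 : cfcₙ (fun t => (2 * r) • s t - s t * s t) b = (2 * r) • e - e * e := by
      rw [cfcₙ_sub (fun t => (2 * r) • s t) (fun t => s t * s t) b,
        cfcₙ_smul (2 * r) s b, cfcₙ_mul s s b]
    rw [← h1]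
    conv_rhs => rw [← cfcₙ_id ℝ b]
    refine cfcₙ_congr fun t ht => ?_
    have htn : t ≤ r ^ 2 := by
      have h2 : ‖t‖ ≤ ‖b‖ := NonUnitalIsometricContinuousFunctionalCalculus.norm_quasispectrum_le b ht
      rw [hb, CStarRing.norm_star_mul_self, ← pow_two] at h2
      exact (le_abs_self t).trans h2
    have h3 := Real.sq_sqrt (sub_nonneg.2 htn)
    simp only [hs, smul_eq_mul, id]
    nlinarith
  have hR : ∀ ζ ζ' : E, ip (B := B) ζ ((r : ℂ) • ζ') = r • ip ζ ζ' := fun ζ ζ' => by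
    rw [ip_smul_right, Complex.coe_smul]
  have hL : ∀ ζ ζ' : E, ip (B := B) ((r : ℂ) • ζ) ζ' = r • ip ζ ζ' := fun ζ ζ' => by
    rw [ip_smul_left, Complex.star_def, Complex.conj_ofReal, Complex.coe_smul]
  have hφb : ip (B := B) (φ a ξ) (φ a ξ) = (2 * r) • ip ξ (φ e ξ) - ip ξ (φ e (φ e ξ)) := by
    have h4 : φ b ξ = ((2 * r : ℝ) : ℂ) • φ e ξ - φ e (φ e ξ) := by
      rw [← hid, map_sub, LinearMap.sub_apply, hmul, ← Complex.coe_smul, map_smul,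
        LinearMap.smul_apply]
    rw [hadj, ← hmul, ← hb, h4, ip_sub_right, ip_smul_right, Complex.coe_smul]
  have hpos : 0 ≤ ip (B := B) ((r : ℂ) • ξ - φ e ξ) ((r : ℂ) • ξ - φ e ξ) := ip_self_nonneg _
  have hexp : ip (B := B) ((r : ℂ) • ξ - φ e ξ) ((r : ℂ) • ξ - φ e ξ)
      = (r ^ 2) • ip ξ ξ - ip (φ a ξ) (φ a ξ) := by
    simp only [ip_sub_left, ip_sub_right, hR, hL, hφb, hadj, hesa]
    module
  rw [hexp] at hpos
  exact sub_nonneg.1 hpos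

variable (B E) in
/-- The norm `‖ξ‖ = ‖⟪ξ, ξ⟫‖ ^ (1/2)` of a pre-Hilbert module. -/
theorem normCore : letI : Norm E := ⟨fun ξ => √‖ip (B := B) ξ ξ‖⟩
    NormedSpace.Core ℂ E :=
  letI : Norm E := ⟨fun ξ => √‖ip (B := B) ξ ξ‖⟩
  { norm_nonneg := fun _ => Real.sqrt_nonneg _
    norm_smul := fun c ξ => by
      change √_ = _ * √_
      rw [ip_smul_left, ip_smul_right, norm_smul, norm_smul, norm_star, ← mul_assoc,
        Real.sqrt_mul (by positivity), Real.sqrt_mul_self (norm_nonneg _)]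
    norm_triangle := fun ξ η => by
      change √_ ≤ √_ + √_
      have hcs : ‖ip (B := B) ξ η‖ ≤ √‖ip (B := B) ξ ξ‖ * √‖ip (B := B) η η‖ := by
        rw [← Real.sqrt_mul (norm_nonneg _)]
        exact Real.le_sqrt_of_sq_le (norm_ip_sq_le ξ η)
      have hsw : ‖ip (B := B) η ξ‖ = ‖ip (B := B) ξ η‖ := by rw [← star_ip, norm_star]
      rw [Real.sqrt_le_left (by positivity), ip_add_left, ip_add_right, ip_add_right]
      have h1 := norm_add_le (ip (B := B) ξ ξ + ip ξ η) (ip η ξ + ip η η)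
      have h2 := norm_add_le (ip (B := B) ξ ξ) (ip ξ η)
      have h3 := norm_add_le (ip (B := B) η ξ) (ip η η)
      have h4 := Real.sq_sqrt (norm_nonneg (ip (B := B) ξ ξ))
      have h5 := Real.sq_sqrt (norm_nonneg (ip (B := B) η η))
      nlinarith
    norm_eq_zero_iff := fun ξ => by
      change √_ = 0 ↔ _
      rw [Real.sqrt_eq_zero (norm_nonneg _), norm_eq_zero]
      exact ⟨eq_zero_of_ip_self ξ, fun h => by rw [h, ip_zero_left]⟩ }

end PreHilbertModule

/-- A right Hilbert `B`-module: a pre-Hilbert module, complete for the norm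
`‖ξ‖ = ‖⟪ξ, ξ⟫‖ ^ (1/2)`. -/
class HilbertModule (B : Type*) (E : Type*) [NonUnitalCStarAlgebra B] [PartialOrder B]
    [NormedAddCommGroup E] [NormedSpace ℂ E] extends PreHilbertModule B E, CompleteSpace E where
  norm_eq_sqrt : ∀ ξ : E, ‖ξ‖ = √‖ip ξ ξ‖

/-! ### C⋆-correspondences -/

/-- An `A`-`B` C⋆-correspondence: a right Hilbert `B`-module with a left action given by a
non-degenerate `*`-homomorphism `φ` from `A` to the adjointable operators
(`φ (star a)` is the adjoint of `φ a`). -/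
structure Correspondence (A B : Type*) [NonUnitalCStarAlgebra A]
    [NonUnitalCStarAlgebra B] [PartialOrder B] where
  carrier : Type w
  [normedAddCommGroup : NormedAddCommGroup carrier]
  [normedSpace : NormedSpace ℂ carrier]
  [hilbertModule : HilbertModule B carrier]
  φ : A →ₗ[ℂ] carrier →ₗ[ℂ] carrier
  φ_mul : ∀ (a b : A) (ξ : carrier), φ (a * b) ξ = φ a (φ b ξ)
  φ_adjoint : ∀ (a : A) (ξ η : carrier),
    PreHilbertModule.ip (B := B) (φ a ξ) η = PreHilbertModule.ip ξ (φ (star a) η)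
  nondegenerate : (Submodule.span ℂ {ζ : carrier | ∃ a ξ, φ a ξ = ζ}).topologicalClosure = ⊤

attribute [instance] Correspondence.normedAddCommGroup Correspondence.normedSpace
  Correspondence.hilbertModule

namespace Correspondence

variable {A B D : Type*} [NonUnitalCStarAlgebra A] [NonUnitalCStarAlgebra B] [PartialOrder B]
  [NonUnitalCStarAlgebra D] [PartialOrder D]

/-- The inner product of a correspondence. -/
abbrev ip (X : Correspondence.{w} A B) (ξ η : X.carrier) : B := PreHilbertModule.ip ξ η

/-- The right action of a correspondence. -/
abbrev rsmul (X : Correspondence.{w} A B) : X.carrier →ₗ[ℂ] B →ₗ[ℂ] X.carrier :=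
  PreHilbertModule.rsmul

theorem φ_rsmul (X : Correspondence.{w} A B) (a : A) (ξ : X.carrier) (b : B) :
    X.φ a (X.rsmul ξ b) = X.rsmul (X.φ a ξ) b := by
  refine PreHilbertModule.ip_right_ext (B := B) _ _ fun ζ => ?_
  have h := X.φ_adjoint (star a)
  rw [star_star] at h
  rw [← h, PreHilbertModule.ip_rsmul_right, PreHilbertModule.ip_rsmul_right, h]

/-- The balanced bilinear map `m` exhibits `Z` as the interior tensor product `X ⊗_B Y`, that is,
`ξ ⊗ η ↦ m ξ η` extends to an isomorphism of `A`-`D` correspondences from the completion of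
`X ⊙_B Y` for `⟪ξ ⊗ η, ξ' ⊗ η'⟫ = ⟪η, ⟪ξ, ξ'⟫ η'⟫` onto `Z`: it is a bimodule map, it preserves
inner products (hence is balanced), and it has dense range. -/
structure IsTensorIso (X : Correspondence.{w} A B) (Y : Correspondence.{w} B D)
    (Z : Correspondence.{w} A D) (m : X.carrier →ₗ[ℂ] Y.carrier →ₗ[ℂ] Z.carrier) : Prop where
  ip_map : ∀ ξ ξ' η η', Z.ip (m ξ η) (m ξ' η') = Y.ip η (Y.φ (X.ip ξ ξ') η')
  map_left : ∀ a ξ η, m (X.φ a ξ) η = Z.φ a (m ξ η)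
  map_right : ∀ ξ η d, m ξ (Y.rsmul η d) = Z.rsmul (m ξ η) d
  dense_range : (Submodule.span ℂ {ζ | ∃ ξ η, m ξ η = ζ}).topologicalClosure = ⊤

theorem norm_rsmul_le (X : Correspondence.{w} A B) (ξ : X.carrier) (b : B) :
    ‖X.rsmul ξ b‖ ≤ ‖b‖ * ‖ξ‖ := by
  rw [HilbertModule.norm_eq_sqrt (B := B), HilbertModule.norm_eq_sqrt (B := B) ξ,
    ← Real.sqrt_sq (norm_nonneg b), ← Real.sqrt_mul (sq_nonneg _),
    PreHilbertModule.ip_rsmul_right, PreHilbertModule.ip_rsmul_left]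
  refine Real.sqrt_le_sqrt ((norm_mul_le _ _).trans ?_)
  calc _ ≤ (‖star b‖ * ‖PreHilbertModule.ip (B := B) ξ ξ‖) * ‖b‖ := by
        gcongr; exact norm_mul_le _ _
    _ = _ := by rw [norm_star]; ring

/-- An operator preserving a set `S` preserves its closed linear span. -/
theorem closedSpan_map_mem (X : Correspondence.{w} A B) (T : X.carrier →ₗ[ℂ] X.carrier) (K : ℝ)
    (hT : ∀ ξ, ‖T ξ‖ ≤ K * ‖ξ‖) (S : Set X.carrier) (hS : ∀ ξ ∈ S, T ξ ∈ S) {ξ : X.carrier}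
    (hξ : ξ ∈ (Submodule.span ℂ S).topologicalClosure) :
    T ξ ∈ (Submodule.span ℂ S).topologicalClosure := by
  have hc : Continuous T := (T.mkContinuous K hT).continuous
  have h : (Submodule.span ℂ S).topologicalClosure ≤
      (Submodule.span ℂ S).topologicalClosure.comap T := by
    refine Submodule.topologicalClosure_minimal _ (Submodule.span_le.2 fun ζ hζ => ?_)
      ((Submodule.isClosed_topologicalClosure _).preimage hc)
    exact Submodule.le_topologicalClosure _ (Submodule.subset_span (hS ζ hζ))
  exact h hξ

variable [StarOrderedRing B]

theorem norm_φ_le (X : Correspondence.{w} A B) (a : A) (ξ : X.carrier) :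
    ‖X.φ a ξ‖ ≤ ‖a‖ * ‖ξ‖ := by
  have h := PreHilbertModule.ip_action_le (B := B) X.φ X.φ_mul X.φ_adjoint a ξ
  have h1 := CStarAlgebra.norm_le_norm_of_nonneg_of_le (PreHilbertModule.ip_self_nonneg _) h
  rw [HilbertModule.norm_eq_sqrt (B := B), HilbertModule.norm_eq_sqrt (B := B) ξ,
    ← Real.sqrt_sq (norm_nonneg a), ← Real.sqrt_mul (sq_nonneg _)]
  refine Real.sqrt_le_sqrt (h1.trans_eq ?_)
  rw [norm_smul, Real.norm_of_nonneg (sq_nonneg _)]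

end Correspondence

/-! ### Quasi-lattice ordered groupoids -/

section Groupoids

variable {C : Type u} [Groupoid.{v} C]

/-- The relation `f ≤ g ↔ f⁻¹ g ∈ P` on morphisms of a groupoid (with the same target);
the composite `f⁻¹ g` is written `g ≫ f⁻¹` in Mathlib. -/
def morLE (P : MorphismProperty C) {a b c : C} (f : a ⟶ c) (g : b ⟶ c) : Prop :=
  P (g ≫ Groupoid.inv f)

/-- `(G, P)` is a quasi-lattice ordered groupoid. Here `G` is the groupoid `C` and `P` is a wide
subcategory, that is, a class of morphisms that contains all identities and is closed under
composition. -/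
class QuasiLatticeOrdered (P : MorphismProperty C) : Prop extends P.IsMultiplicative where
  /-- `P(x, y) ∩ P⁻¹(x, y)` is empty for `x ≠ y`, and contains only `1_x` for `x = y`. -/
  eq_id : ∀ {x y : C} (f : x ⟶ y), P f → P (Groupoid.inv f) → ∃ h : x = y, f = eqToHom h
  /-- A finite nonempty set of morphisms of `G` with an upper bound in `P` (so that all have the
  same target) has a least upper bound in `P`. -/
  exists_lub : ∀ {y : C} (S : Set (Σ x : C, (x ⟶ y))), S.Finite → S.Nonempty →
    (∃ p : Σ x : C, (x ⟶ y), P p.2 ∧ ∀ f ∈ S, morLE P f.2 p.2) →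
    ∃ p : Σ x : C, (x ⟶ y), P p.2 ∧ (∀ f ∈ S, morLE P f.2 p.2) ∧
      ∀ q : Σ x : C, (x ⟶ y), P q.2 → (∀ f ∈ S, morLE P f.2 q.2) → morLE P p.2 q.2

/-- The set `P(x, y)` of morphisms in `P` with source `x` and target `y`. -/
@[ext]
structure PHom (P : MorphismProperty C) (x y : C) where
  hom : x ⟶ y
  mem : P hom

namespace PHom

variable {P : MorphismProperty C}

/-- The order of `G`, restricted to `P`. -/
def le {a b c : C} (f : PHom P a c) (g : PHom P b c) : Prop := morLE P f.hom g.hom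

/-- The strict order. -/
def lt {a b c : C} (f : PHom P a c) (g : PHom P b c) : Prop := f.le g ∧ ¬ g.le f

/-- The element `f⁻¹ g` of `P`, for `f ≤ g`. -/
def div {a b c : C} (f : PHom P a c) (g : PHom P b c) (h : f.le g) : PHom P b a :=
  ⟨g.hom ≫ Groupoid.inv f.hom, h⟩

/-- The identity `1_x`. -/
def one (P : MorphismProperty C) [P.IsMultiplicative] (x : C) : PHom P x x := ⟨𝟙 x, P.id_mem x⟩

/-- The product `g f` (first `f`, then `g`). -/
def mul [P.IsMultiplicative] {x y z : C} (g : PHom P y z) (f : PHom P x y) : PHom P x z :=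
  ⟨f.hom ≫ g.hom, P.comp_mem _ _ f.mem g.mem⟩

/-- A set `S ⊆ P(x, y)` is bounded: some `g ∈ P(-, y)` is above all its elements. -/
def IsBounded {x y : C} (S : Set (PHom P x y)) : Prop :=
  ∃ (z : C) (g : PHom P z y), ∀ k ∈ S, k.le g

/-- `f` is a maximal element of `S`. -/
def IsMaximal {x y : C} (S : Set (PHom P x y)) (f : PHom P x y) : Prop :=
  f ∈ S ∧ ∀ h ∈ S, h ≠ f → ¬ f.le h

/-- `f` is a minimal element of `S`. -/
def IsMinimal {x y : C} (S : Set (PHom P x y)) (f : PHom P x y) : Prop :=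
  f ∈ S ∧ ∀ h ∈ S, h ≠ f → ¬ h.le f

end PHom

/-! ### Product systems -/

/-- A product system over `(G, P)`: C⋆-correspondences `X_f` from `A_{t(f)}` to `A_{s(f)}`, and
isomorphisms `m_{g,f} : X_g ⊗ X_f → X_{gf}` given as bilinear maps. To avoid transport along
equations of morphisms, `m` is indexed by `g`, `f` and a morphism `k` equal to `g f`. The equality
`X_{1_x} = A_x` is an identification `one` of `X_{1_x}` with the standard correspondence `A_x`,
with `⟪a, b⟫ = a* b` and multiplication on both sides. -/
structure ProductSystem (P : MorphismProperty C) [P.IsMultiplicative] (A : C → Type*)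
    [∀ x, NonUnitalCStarAlgebra (A x)] [∀ x, PartialOrder (A x)] where
  X : ∀ {x y : C}, PHom P x y → Correspondence.{w} (A y) (A x)
  m : ∀ {x y z : C} (g : PHom P y z) (f : PHom P x y) (k : PHom P x z), k = g.mul f →
    ((X g).carrier →ₗ[ℂ] (X f).carrier →ₗ[ℂ] (X k).carrier)
  isTensorIso : ∀ {x y z : C} (g : PHom P y z) (f : PHom P x y) (k : PHom P x z)
    (hk : k = g.mul f), Correspondence.IsTensorIso (X g) (X f) (X k) (m g f k hk)
  one : ∀ x : C, A x ≃ₗ[ℂ] (X (PHom.one P x)).carrier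
  ip_one : ∀ (x : C) (a b : A x), (X (PHom.one P x)).ip (one x a) (one x b) = star a * b
  φ_one : ∀ (x : C) (a b : A x), (X (PHom.one P x)).φ a (one x b) = one x (a * b)
  rsmul_one : ∀ (x : C) (a b : A x), (X (PHom.one P x)).rsmul (one x a) b = one x (a * b)
  one_m : ∀ {x y : C} (f : PHom P x y) (h : f = (PHom.one P y).mul f) (a : A y)
    (ξ : (X f).carrier), m (PHom.one P y) f f h (one y a) ξ = (X f).φ a ξ
  m_one : ∀ {x y : C} (f : PHom P x y) (h : f = f.mul (PHom.one P x)) (ξ : (X f).carrier)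
    (b : A x), m f (PHom.one P x) f h ξ (one x b) = (X f).rsmul ξ b
  m_assoc : ∀ {x y z t : C} (h : PHom P z t) (g : PHom P y z) (f : PHom P x y)
    (hg : PHom P y t) (gf : PHom P x z) (k : PHom P x t)
    (e₁ : hg = h.mul g) (e₂ : k = hg.mul f) (e₃ : gf = g.mul f) (e₄ : k = h.mul gf)
    (ζ : (X h).carrier) (η : (X g).carrier) (ξ : (X f).carrier),
    m hg f k e₂ (m h g hg e₁ ζ η) ξ = m h gf k e₄ ζ (m g f gf e₃ η ξ)

namespace ProductSystem

variable {P : MorphismProperty C} [P.IsMultiplicative] {A : C → Type*}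
  [∀ x, NonUnitalCStarAlgebra (A x)] [∀ x, PartialOrder (A x)]

/-- The ideal `I_g` of `A_y` for `g ∈ P(x, y)`: the intersection of the kernels of `φ_f` over all
`f` with `1_y < f ≤ g` if `x = y`, and `0` if `x ≠ y`. For `g = 1_y` the intersection is empty, so
that `I_g = A_y`; see `idealI_one`. -/
noncomputable def idealI (X : ProductSystem.{w} P A) {x y : C} (g : PHom P x y) :
    Submodule ℂ (A y) :=
  open Classical in
  if x = y then
    ⨅ (z : C) (f : PHom P z y) (_ : (PHom.one P y).lt f) (_ : f.le g), LinearMap.ker (X.X f).φ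
  else ⊥

theorem idealI_one (X : ProductSystem.{w} P A) (y : C) : X.idealI (PHom.one P y) = ⊤ := by
  simp only [idealI, if_true, iInf_eq_top]
  intro z f h1 h2
  exact absurd h2 h1.2

theorem mul_mem_idealI (X : ProductSystem.{w} P A) {x y : C} (g : PHom P x y) {i : A y}
    (hi : i ∈ X.idealI g) (b : A y) : i * b ∈ X.idealI g := by
  unfold idealI at hi ⊢
  split_ifs at hi ⊢ with h
  · simp only [Submodule.mem_iInf, LinearMap.mem_ker] at hi ⊢
    intro z f h1 h2
    ext ξ
    rw [(X.X f).φ_mul, hi z f h1 h2, LinearMap.zero_apply, LinearMap.zero_apply]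
  · rw [Submodule.mem_bot] at hi ⊢
    rw [hi, zero_mul]

/-- The closed submodule `X_f I_{f⁻¹ g}` of `X_f`, for `f ≤ g` in `P(x, y)`. -/
noncomputable def cutSubmodule (X : ProductSystem.{w} P A) {x y : C} (g f : PHom P x y)
    (h : f.le g) : Submodule ℂ (X.X f).carrier :=
  (Submodule.span ℂ {ζ | ∃ ξ, ∃ i ∈ X.idealI (f.div g h), (X.X f).rsmul ξ i = ζ}).topologicalClosure

/-- The space `C_c^g(X)` of finitely supported maps `ξ` on `{f ∈ P(x, y) : f ≤ g}` such that
`ξ(f) ∈ X_f I_{f⁻¹ g}`. -/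
noncomputable def Cc (X : ProductSystem.{w} P A) {x y : C} (g : PHom P x y) :
    Submodule ℂ (∀ f : {f : PHom P x y // f.le g}, (X.X f.1).carrier) where
  carrier := {ξ | (∀ f, ξ f ∈ X.cutSubmodule g f.1 f.2) ∧ {f | ξ f ≠ 0}.Finite}
  zero_mem' := ⟨fun f => Submodule.zero_mem _, by simp⟩
  add_mem' := fun {ξ η} hξ hη => ⟨fun f => Submodule.add_mem _ (hξ.1 f) (hη.1 f),
    (hξ.2.union hη.2).subset fun f hf => by
      by_contra hcon
      have h1 : ξ f = 0 := by_contra fun h => hcon (Or.inl h)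
      have h2 : η f = 0 := by_contra fun h => hcon (Or.inr h)
      exact hf (by rw [Pi.add_apply, h1, h2, add_zero])⟩
  smul_mem' := fun c ξ hξ => ⟨fun f => Submodule.smul_mem _ c (hξ.1 f),
    hξ.2.subset fun f hf h0 => hf (by rw [Pi.smul_apply, h0, smul_zero])⟩

/-- The space `C_c^g(X)` as a type of its own, normed by its inner product. -/
def CcSpace (X : ProductSystem.{w} P A) {x y : C} (g : PHom P x y) : Type _ := X.Cc g

noncomputable instance (X : ProductSystem.{w} P A) {x y : C} (g : PHom P x y) :
    AddCommGroup (X.CcSpace g) :=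
  inferInstanceAs (AddCommGroup (X.Cc g))

noncomputable instance (X : ProductSystem.{w} P A) {x y : C} (g : PHom P x y) :
    Module ℂ (X.CcSpace g) :=
  inferInstanceAs (Module ℂ (X.Cc g))

theorem rsmul_mem_cutSubmodule (X : ProductSystem.{w} P A) {x y : C} (g f : PHom P x y)
    (h : f.le g) {ξ : (X.X f).carrier} (hξ : ξ ∈ X.cutSubmodule g f h) (b : A x) :
    (X.X f).rsmul ξ b ∈ X.cutSubmodule g f h := by
  refine (X.X f).closedSpan_map_mem ((X.X f).rsmul.flip b) ‖b‖
    (fun ζ => (X.X f).norm_rsmul_le ζ b) _ ?_ hξ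
  rintro _ ⟨ζ, i, hi, rfl⟩
  exact ⟨ζ, i * b, X.mul_mem_idealI _ hi b, (PreHilbertModule.rsmul_rsmul ζ i b).symm⟩

section Analytic

variable [∀ x, StarOrderedRing (A x)]

theorem φ_mem_cutSubmodule (X : ProductSystem.{w} P A) {x y : C} (g f : PHom P x y)
    (h : f.le g) {ξ : (X.X f).carrier} (hξ : ξ ∈ X.cutSubmodule g f h) (a : A y) :
    (X.X f).φ a ξ ∈ X.cutSubmodule g f h := by
  refine (X.X f).closedSpan_map_mem ((X.X f).φ a) ‖a‖
    (fun ζ => (X.X f).norm_φ_le a ζ) _ ?_ hξ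
  rintro _ ⟨ζ, i, hi, rfl⟩
  exact ⟨(X.X f).φ a ζ, i, hi, ((X.X f).φ_rsmul a ζ i).symm⟩

/-- The pre-Hilbert `A_x`-module structure of `C_c^g(X)`: `(ξ · a)(f) = ξ(f) a` and
`⟪ξ, η⟫ = ∑_f ⟪ξ(f), η(f)⟫`. -/
noncomputable instance (X : ProductSystem.{w} P A) {x y : C} (g : PHom P x y) :
    PreHilbertModule (A x) (X.CcSpace g) where
  rsmul := LinearMap.mk₂ ℂ
    (fun ξ b => ⟨fun f => (X.X f.1).rsmul (ξ.1 f) b,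
      fun f => X.rsmul_mem_cutSubmodule g f.1 f.2 (ξ.2.1 f) b,
      ξ.2.2.subset fun f hf h0 => hf (by
        change (X.X f.1).rsmul (ξ.1 f) b = 0
        rw [h0, map_zero, LinearMap.zero_apply])⟩)
    (fun ξ η b => Subtype.ext (funext fun f => LinearMap.map_add₂ _ (ξ.1 f) (η.1 f) b))
    (fun c ξ b => Subtype.ext (funext fun f => LinearMap.map_smul₂ _ c (ξ.1 f) b))
    (fun ξ b b' => Subtype.ext (funext fun f => map_add ((X.X f.1).rsmul (ξ.1 f)) b b'))
    (fun c ξ b => Subtype.ext (funext fun f => map_smul ((X.X f.1).rsmul (ξ.1 f)) c b))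
  ip ξ η := ∑ᶠ f, (X.X f.1).ip (ξ.1 f) (η.1 f)
  rsmul_rsmul ξ b c :=
    Subtype.ext (funext fun f => PreHilbertModule.rsmul_rsmul (ξ.1 f) b c)
  ip_add_right ξ η ζ := by
    rw [← finsum_add_distrib]
    · exact finsum_congr fun f => PreHilbertModule.ip_add_right (ξ.1 f) (η.1 f) (ζ.1 f)
    all_goals
      refine ξ.2.2.subset fun f hf h0 => hf ?_
      simp only [h0]
      exact PreHilbertModule.ip_zero_left (B := A x) _
  ip_smul_right z ξ η := by
    rw [smul_finsum]
    exact finsum_congr fun f => PreHilbertModule.ip_smul_right z (ξ.1 f) (η.1 f)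
  ip_rsmul_right ξ η b := by
    rw [finsum_mul' _ _ (ξ.2.2.subset fun f hf h0 => hf (by
      simp only [h0]
      exact PreHilbertModule.ip_zero_left (B := A x) _))]
    exact finsum_congr fun f => PreHilbertModule.ip_rsmul_right (ξ.1 f) (η.1 f) b
  star_ip ξ η := by
    have h := (starAddEquiv : A x ≃+ A x).toAddMonoidHom.map_finsum
      (f := fun f => (X.X f.1).ip (ξ.1 f) (η.1 f)) (ξ.2.2.subset fun f hf h0 => hf (by
        simp only [h0]
        exact PreHilbertModule.ip_zero_left (B := A x) _))
    refine h.trans (finsum_congr fun f => PreHilbertModule.star_ip (ξ.1 f) (η.1 f))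
  ip_self_nonneg ξ := finsum_nonneg fun f => PreHilbertModule.ip_self_nonneg (B := A x) (ξ.1 f)
  eq_zero_of_ip_self ξ h := by
    refine Subtype.ext (funext fun f => PreHilbertModule.eq_zero_of_ip_self (B := A x) _ ?_)
    refine le_antisymm ?_ (PreHilbertModule.ip_self_nonneg _)
    rw [← h]
    exact single_le_finsum f (ξ.2.2.subset fun f hf h0 => hf (by
        simp only [h0]
        exact PreHilbertModule.ip_zero_left (B := A x) _))
      fun f => PreHilbertModule.ip_self_nonneg (B := A x) (ξ.1 f)

noncomputable instance (X : ProductSystem.{w} P A) {x y : C} (g : PHom P x y) :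
    NormedAddCommGroup (X.CcSpace g) :=
  letI : Norm (X.CcSpace g) := ⟨fun ξ => √‖PreHilbertModule.ip (B := A x) ξ ξ‖⟩
  NormedAddCommGroup.ofCore (PreHilbertModule.normCore (A x) (X.CcSpace g))

noncomputable instance (X : ProductSystem.{w} P A) {x y : C} (g : PHom P x y) :
    NormedSpace ℂ (X.CcSpace g) :=
  letI : Norm (X.CcSpace g) := ⟨fun ξ => √‖PreHilbertModule.ip (B := A x) ξ ξ‖⟩
  NormedSpace.ofCore (PreHilbertModule.normCore (A x) (X.CcSpace g))

theorem CcSpace.norm_eq_sqrt (X : ProductSystem.{w} P A) {x y : C} (g : PHom P x y)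
    (ξ : X.CcSpace g) : ‖ξ‖ = √‖PreHilbertModule.ip (B := A x) ξ ξ‖ := rfl

/-- The left action of `A_y` on `C_c^g(X)`: `(a ξ)(f) = φ_f(a) ξ(f)`. -/
noncomputable def CcSpace.φ (X : ProductSystem.{w} P A) {x y : C} (g : PHom P x y) :
    A y →ₗ[ℂ] X.CcSpace g →ₗ[ℂ] X.CcSpace g :=
  LinearMap.mk₂ ℂ
    (fun a ξ => ⟨fun f => (X.X f.1).φ a (ξ.1 f),
      fun f => X.φ_mem_cutSubmodule g f.1 f.2 (ξ.2.1 f) a,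
      ξ.2.2.subset fun f hf h0 => hf (by
        change (X.X f.1).φ a (ξ.1 f) = 0
        rw [h0, map_zero])⟩)
    (fun a b ξ => Subtype.ext (funext fun f => LinearMap.map_add₂ _ a b (ξ.1 f)))
    (fun c a ξ => Subtype.ext (funext fun f => LinearMap.map_smul₂ _ c a (ξ.1 f)))
    (fun a ξ η => Subtype.ext (funext fun f => map_add ((X.X f.1).φ a) (ξ.1 f) (η.1 f)))
    (fun c a ξ => Subtype.ext (funext fun f => map_smul ((X.X f.1).φ a) c (ξ.1 f)))

theorem CcSpace.φ_mul (X : ProductSystem.{w} P A) {x y : C} (g : PHom P x y) (a b : A y)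
    (ξ : X.CcSpace g) : CcSpace.φ X g (a * b) ξ = CcSpace.φ X g a (CcSpace.φ X g b ξ) :=
  Subtype.ext (funext fun f => (X.X f.1).φ_mul a b (ξ.1 f))

theorem CcSpace.φ_adjoint (X : ProductSystem.{w} P A) {x y : C} (g : PHom P x y) (a : A y)
    (ξ η : X.CcSpace g) : PreHilbertModule.ip (B := A x) (CcSpace.φ X g a ξ) η =
      PreHilbertModule.ip (B := A x) ξ (CcSpace.φ X g (star a) η) :=
  finsum_congr fun f => (X.X f.1).φ_adjoint a (ξ.1 f) (η.1 f)

theorem CcSpace.norm_φ_le (X : ProductSystem.{w} P A) {x y : C} (g : PHom P x y) (a : A y)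
    (ξ : X.CcSpace g) : ‖CcSpace.φ X g a ξ‖ ≤ ‖a‖ * ‖ξ‖ := by
  have h := PreHilbertModule.ip_action_le (B := A x) (CcSpace.φ X g) (CcSpace.φ_mul X g)
    (CcSpace.φ_adjoint X g) a ξ
  have h1 := CStarAlgebra.norm_le_norm_of_nonneg_of_le (PreHilbertModule.ip_self_nonneg _) h
  rw [CcSpace.norm_eq_sqrt, CcSpace.norm_eq_sqrt, ← Real.sqrt_sq (norm_nonneg a),
    ← Real.sqrt_mul (sq_nonneg _)]
  refine Real.sqrt_le_sqrt (h1.trans_eq ?_)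
  rw [norm_smul, Real.norm_of_nonneg (sq_nonneg _)]

/-- The space `X̃_g`, the completion of `C_c^g(X)`. -/
abbrev XTilde (X : ProductSystem.{w} P A) {x y : C} (g : PHom P x y) : Type _ :=
  UniformSpace.Completion (X.CcSpace g)

/-- The left action `φ̃_g(a)` of `a ∈ A_y` on `X̃_g`: the continuous extension of
`(a ξ)(f) = φ_f(a) ξ(f)`. -/
noncomputable def φTilde (X : ProductSystem.{w} P A) {x y : C} (g : PHom P x y) (a : A y) :
    X.XTilde g →L[ℂ] X.XTilde g :=
  (UniformSpace.Completion.toComplL.comp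
    ((CcSpace.φ X g a).mkContinuous ‖a‖ (CcSpace.norm_φ_le X g a))).extend
      UniformSpace.Completion.toComplL

theorem φTilde_coe (X : ProductSystem.{w} P A) {x y : C} (g : PHom P x y) (a : A y)
    (ξ : X.CcSpace g) :
    X.φTilde g a (ξ : X.XTilde g) = (CcSpace.φ X g a ξ : X.CcSpace g) :=
  ContinuousLinearMap.extend_eq _ UniformSpace.Completion.denseRange_coe
    (UniformSpace.Completion.isUniformInducing_coe _) ξ

/-- `X` is `φ̃`-injective if every `φ̃_g` is injective. -/
def IsφTildeInjective (X : ProductSystem.{w} P A) : Prop :=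
  ∀ (x y : C) (g : PHom P x y), Function.Injective (X.φTilde g)

end Analytic

end ProductSystem

end Groupoids

/-! Suppose `φ̃_g(a) = 0`. Testing on families supported at one point gives `φ_f(a)(ξ i) = 0` for
all `f ≤ g` parallel to `g`, `ξ ∈ X_f` and `i ∈ I_{f⁻¹g}` (`φ_rsmul_eq_zero`). The natural choice is
`i = b := ⟪φ_f(a) ξ, φ_f(a) ξ⟫`: if `b ∈ I_{f⁻¹g}`, pairing `φ_f(a)(ξ b) = 0` with `φ_f(a) ξ` gives
`b² = 0`, so `φ_f(a) ξ = 0` (`Correspondence.φ_eq_zero_of_rsmul_ip`). Everything reduces to finding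
`f` with `b ∈ I_{f⁻¹g}`.

If all `φ_f` are injective, `f = g` works, because `I_{1_x} = A_x`.

Otherwise, for `a ≠ 0`, take `f` maximal among the parallel `f ≤ g` with `φ_f(a) ≠ 0`. For an
endomorphism `k` with `1 < k ≤ f⁻¹g`, maximality forces `φ_{fk}(a) = 0`, and `X_f ⊗ X_k ≅ X_{fk}`
turns this into `φ_k(b) = 0` (`Correspondence.IsTensorIso.φ_ip_eq_zero`). The ideal also involves
`k` with other sources; these are extended to endomorphisms by a morphism acting injectively
(`mem_idealI_of_endo`). Hence `b ∈ I_{f⁻¹g}` and `φ_f(a) = 0`, a contradiction. -/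

/-! ### C⋆-correspondences and interior tensor products -/

/-- In an interior tensor product `Z = X ⊗ Y`: if `φ_Z(a) = 0`, then
`φ_Y(⟪φ_X(a) ξ, φ_X(a) ξ⟫) = 0`. -/
theorem Correspondence.IsTensorIso.φ_ip_eq_zero {A B D : Type*} [NonUnitalCStarAlgebra A]
    [NonUnitalCStarAlgebra B] [PartialOrder B] [NonUnitalCStarAlgebra D] [PartialOrder D]
    {X : Correspondence A B} {Y : Correspondence B D} {Z : Correspondence A D}
    {m : X.carrier →ₗ[ℂ] Y.carrier →ₗ[ℂ] Z.carrier} (h : Correspondence.IsTensorIso X Y Z m)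
    {a : A} (ha : Z.φ a = 0) (ξ : X.carrier) :
    Y.φ (X.ip (X.φ a ξ) (X.φ a ξ)) = 0 := by
  ext η
  refine PreHilbertModule.ip_right_ext (B := D) _ _ fun ζ => ?_
  -- The pairing of `ζ` with `φ_Y(⟪φ_X(a) ξ, φ_X(a) ξ⟫) η` is the inner product in `Z` of two
  -- vectors in the range of `φ_Z(a)`.
  refine (h.ip_map _ _ _ _).symm.trans ?_
  rw [h.map_left, ha]
  simp only [PreHilbertModule.ip_zero_right, LinearMap.zero_apply]
  exact PreHilbertModule.ip_zero_left (B := D) _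

/-- If `φ(a)` vanishes on `ξ · ⟪φ(a) ξ, φ(a) ξ⟫`, then it vanishes on `ξ`. -/
theorem Correspondence.φ_eq_zero_of_rsmul_ip {A B : Type*} [NonUnitalCStarAlgebra A]
    [NonUnitalCStarAlgebra B] [PartialOrder B] (X : Correspondence A B) {a : A} {ξ : X.carrier}
    (h : X.φ a (X.rsmul ξ (X.ip (X.φ a ξ) (X.φ a ξ))) = 0) : X.φ a ξ = 0 := by
  refine PreHilbertModule.eq_zero_of_ip_self (B := B) _ ?_
  rw [X.φ_rsmul] at h
  have h1 := PreHilbertModule.ip_rsmul_right (X.φ a ξ) (X.φ a ξ) (X.ip (X.φ a ξ) (X.φ a ξ))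
  rw [h, PreHilbertModule.ip_zero_right] at h1
  -- With `b = ⟪φ(a) ξ, φ(a) ξ⟫`, `h1` reads `0 = b * b`; since `b` is self-adjoint, the C⋆-identity
  -- gives `b = 0`.
  rw [← CStarRing.star_mul_self_eq_zero_iff, PreHilbertModule.star_ip]
  exact h1.symm

/-! ### The order on `P` and multiplication -/

namespace PHom

variable {C : Type*} [Groupoid C] {P : MorphismProperty C}

theorem le_trans [P.IsMultiplicative] {a b c d : C} {f : PHom P a d} {g : PHom P b d}
    {h : PHom P c d} (hfg : f.le g) (hgh : g.le h) : f.le h := by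
  have := P.comp_mem _ _ hgh hfg
  simpa [le, morLE] using this

theorem le_mul [P.IsMultiplicative] {x y z : C} (g : PHom P y z) (f : PHom P x y) :
    g.le (g.mul f) := by
  simpa [le, morLE, mul] using f.mem

theorem one_le [P.IsMultiplicative] {x y : C} (f : PHom P x y) : (one P y).le f := by
  simpa [le, morLE, one] using f.mem

theorem mul_le_of_le_div [P.IsMultiplicative] {x y z t : C} {f : PHom P y z} {g : PHom P t z}
    {k : PHom P x y} (h : f.le g) (hk : k.le (f.div g h)) : (f.mul k).le g := by
  simpa [le, morLE, mul, div] using hk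

/-- If `k f ≤ 1`, then `k ≤ k f ≤ 1`, against the strictness of `1 < k`. -/
theorem lt_mul_of_lt [P.IsMultiplicative] {x y z : C} {k : PHom P y z}
    (hk : (one P z).lt k) (f : PHom P x y) : (one P z).lt (k.mul f) :=
  ⟨one_le _, fun h => hk.2 (le_trans (le_mul k f) h)⟩

/-- Cancelling `f` in the groupoid would force `k = 1`. -/
theorem mul_ne_self_of_lt [P.IsMultiplicative] {x y : C} (f : PHom P x y) {k : PHom P x x}
    (hk : (one P x).lt k) : f.mul k ≠ f := by
  intro h
  have h1 : k.hom = 𝟙 x := by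
    have h2 : k.hom ≫ f.hom = f.hom := congrArg hom h
    rwa [← cancel_mono f.hom, Category.id_comp]
  obtain rfl : k = one P x := PHom.ext h1
  exact hk.2 hk.1

end PHom

/-! ### Membership in the ideals `I_h` -/

namespace ProductSystem

variable {C : Type*} [Groupoid C] {P : MorphismProperty C} [P.IsMultiplicative]
  {A : C → Type*} [∀ x, NonUnitalCStarAlgebra (A x)] [∀ x, PartialOrder (A x)]

theorem mem_idealI (X : ProductSystem P A) {y : C} (g : PHom P y y) (a : A y) :
    a ∈ X.idealI g ↔ ∀ (z : C) (f : PHom P z y), (PHom.one P y).lt f → f.le g →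
      (X.X f).φ a = 0 := by
  simp [idealI, Submodule.mem_iInf]

theorem mem_idealI_div_self (X : ProductSystem P A) {x y : C} (g : PHom P x y) (h : g.le g)
    (a : A x) : a ∈ X.idealI (g.div g h) := by
  have h1 : g.div g h = PHom.one P x := PHom.ext (by simp [PHom.div, PHom.one])
  rw [h1, X.idealI_one]
  trivial

/-- To lie in `I_h`, it suffices to be killed by `φ_k` for the endomorphisms `1 < k ≤ h`, provided
that below each morphism there is a parallel one acting injectively. -/
theorem mem_idealI_of_endo (X : ProductSystem P A)
    (hinj : ∀ (x y : C) (k : PHom P x y), ∃ f : PHom P x y, f.le k ∧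
      Function.Injective (X.X f).φ)
    {x : C} {h : PHom P x x} {b : A x}
    (hb : ∀ k : PHom P x x, (PHom.one P x).lt k → k.le h → (X.X k).φ b = 0) :
    b ∈ X.idealI h := by
  rw [mem_idealI]
  intro z k hk hkh
  -- Since `k⁻¹h` goes from `x` to `z`, so does `f`; thus `k f` is an endomorphism of `x` with `1 <
  -- k f ≤ h`, and `hb` applies to it. The tensor product lemma then puts `⟪φ_k(b) ξ, φ_k(b) ξ⟫` in
  -- the kernel of the injective `φ_f`.
  obtain ⟨f, hf, hfinj⟩ := hinj x z (k.div h hkh)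
  ext ξ
  refine PreHilbertModule.eq_zero_of_ip_self (B := A z) _ (hfinj ?_)
  rw [map_zero]
  exact (X.isTensorIso k f _ rfl).φ_ip_eq_zero
    (hb _ (PHom.lt_mul_of_lt hk f) (PHom.mul_le_of_le_div hkh hf)) ξ

/-! ### The kernel of `φ̃_g` -/

variable [∀ x, StarOrderedRing (A x)]

theorem φ_eq_zero_of_mem_cutSubmodule (X : ProductSystem P A) {x y : C} {g f : PHom P x y}
    (hf : f.le g) {a : A y} (ha : X.φTilde g a = 0) {ξ : (X.X f).carrier}
    (hξ : ξ ∈ X.cutSubmodule g f hf) : (X.X f).φ a ξ = 0 := by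
  classical
  -- The family with value `ξ` at `f` and `0` elsewhere isolates the component at `f`; its image in
  -- the completion can be tested because the embedding is injective.
  let s : X.CcSpace g := ⟨Pi.single ⟨f, hf⟩ ξ, fun k => by
    by_cases hk : k = ⟨f, hf⟩
    · subst hk
      simpa using hξ
    · rw [Pi.single_eq_of_ne hk]
      exact Submodule.zero_mem _, (Set.finite_singleton ⟨f, hf⟩).subset fun k hk => by
    by_contra hne
    exact hk (Pi.single_eq_of_ne (M := fun k : {k : PHom P x y // k.le g} => (X.X k.1).carrier)
      hne ξ)⟩
  have h1 := X.φTilde_coe g a s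
  rw [ha, zero_apply, ← UniformSpace.Completion.coe_zero,
    UniformSpace.Completion.coe_inj] at h1
  have h2 : (0 : (X.X f).carrier) = (X.X f).φ a (Pi.single (M := fun k : {k : PHom P x y // k.le g}
      => (X.X k.1).carrier) ⟨f, hf⟩ ξ ⟨f, hf⟩) :=
    congrFun (congrArg Subtype.val h1) ⟨f, hf⟩
  rw [Pi.single_eq_same] at h2
  exact h2.symm

theorem φ_rsmul_eq_zero (X : ProductSystem P A) {x y : C} {g f : PHom P x y}
    (hf : f.le g) {a : A y} (ha : X.φTilde g a = 0) (ξ : (X.X f).carrier) {i : A x}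
    (hi : i ∈ X.idealI (f.div g hf)) : (X.X f).φ a ((X.X f).rsmul ξ i) = 0 :=
  X.φ_eq_zero_of_mem_cutSubmodule hf ha
    (Submodule.le_topologicalClosure _ (Submodule.subset_span ⟨ξ, i, hi, rfl⟩))

/-- Each `φ̃_g(a)` is a separate continuous extension, so additivity in `a` is checked on the dense
subspace; it reduces injectivity to a trivial kernel. -/
theorem φTilde_sub (X : ProductSystem P A) {x y : C} (g : PHom P x y) (a b : A y) :
    X.φTilde g (a - b) = X.φTilde g a - X.φTilde g b := by
  ext ξ
  induction ξ using UniformSpace.Completion.induction_on with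
  | hp => exact isClosed_eq (by fun_prop) (by fun_prop)
  | ih ξ =>
    rw [sub_apply, φTilde_coe, φTilde_coe, φTilde_coe,
      ← UniformSpace.Completion.coe_sub, map_sub, LinearMap.sub_apply]

theorem isφTildeInjective_of_forall_eq_zero (X : ProductSystem P A)
    (h : ∀ (x y : C) (g : PHom P x y) (a : A y), X.φTilde g a = 0 → a = 0) :
    X.IsφTildeInjective := fun x y g a b hab =>
  sub_eq_zero.1 (h x y g _ (by rw [φTilde_sub, hab, sub_self]))

/-! ### The two injectivity criteria -/

theorem isφTildeInjective_of_injective (X : ProductSystem P A)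
    (hinj : ∀ (x y : C) (f : PHom P x y), Function.Injective (X.X f).φ) :
    X.IsφTildeInjective := by
  refine X.isφTildeInjective_of_forall_eq_zero fun x y g a ha => hinj x y g ?_
  rw [map_zero]
  ext ξ
  have hg : g.le g := by simpa [PHom.le, morLE] using P.id_mem x
  exact (X.X g).φ_eq_zero_of_rsmul_ip
    (X.φ_rsmul_eq_zero hg ha ξ (X.mem_idealI_div_self g hg _))

theorem isφTildeInjective_of_isMaximal (X : ProductSystem P A)
    (hmax : ∀ (x y : C) (S : Set (PHom P x y)), S.Nonempty → PHom.IsBounded S →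
      ∃ f, PHom.IsMaximal S f)
    (hinj : ∀ (x y : C) (k : PHom P x y), ∃ f : PHom P x y, f.le k ∧
      Function.Injective (X.X f).φ) :
    X.IsφTildeInjective := by
  refine X.isφTildeInjective_of_forall_eq_zero fun x y g a ha => ?_
  by_contra ha0
  obtain ⟨f₀, hf₀, hf₀inj⟩ := hinj x y g
  -- The set is bounded by `g`, and nonempty because `φ_{f₀}` is injective and `a ≠ 0`.
  obtain ⟨f, ⟨hfg, hfa⟩, hfmax⟩ := hmax x y {f | f.le g ∧ (X.X f).φ a ≠ 0}
    ⟨f₀, hf₀, fun h => ha0 (hf₀inj (by rw [h, map_zero]))⟩ ⟨x, g, fun k hk => hk.1⟩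
  refine hfa ?_
  ext ξ
  refine (X.X f).φ_eq_zero_of_rsmul_ip (X.φ_rsmul_eq_zero hfg ha ξ
    (X.mem_idealI_of_endo hinj fun k hk hkg => ?_))
  refine (X.isTensorIso f k _ rfl).φ_ip_eq_zero ?_ ξ
  by_contra hne
  -- As `k` is an endomorphism, `f k` is parallel to `f`; it lies in the set, above `f` and
  -- different from it, contradicting maximality.
  exact hfmax _ ⟨PHom.mul_le_of_le_div hfg hkg, hne⟩ (PHom.mul_ne_self_of_lt f hk)
    (PHom.le_mul f k)

end ProductSystem

theorem mainTheorem3 {C : Type*} [Groupoid C] (P : MorphismProperty C) [QuasiLatticeOrdered P]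
    {A : C → Type*} [∀ x, NonUnitalCStarAlgebra (A x)] [∀ x, PartialOrder (A x)]
    [∀ x, StarOrderedRing (A x)] (X : ProductSystem P A) :
    ((∀ (x y : C) (f : PHom P x y), Function.Injective (X.X f).φ) → X.IsφTildeInjective) ∧
    ((∀ (x y : C) (S : Set (PHom P x y)), S.Nonempty → PHom.IsBounded S →
        ∃ f, PHom.IsMaximal S f) →
      (∀ (x y : C) (k : PHom P x y), ∃ f' : PHom P x y,
        PHom.IsMinimal {f : PHom P x y | f.le k} f' ∧ Function.Injective (X.X f').φ) →
      X.IsφTildeInjective) := by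
  exact ⟨X.isφTildeInjective_of_injective, fun hmax hmin =>
    X.isφTildeInjective_of_isMaximal hmax fun x y k =>
      (hmin x y k).imp fun _ h => ⟨h.1.1, h.2⟩⟩
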